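/- Let $X$ be a compact (Hausdorff, finite-dimensional) $C^1$ manifold, possibly with boundary, and fix a continuous Riemannian metric on $X$; for a linear map between tangent spaces of $X$ let $\|\cdot\|$ be the operator norm with respect to this metric. Let $T:X\to X$ be a $C^1$ diffeomorphism. For $y\in X$ put $O^+(y)=\{T^k(y):k\ge 0\}$. Let $\mathrm M(X,T)$ be the set of minimal points of $T$, that is, of those $y\in X$ for which every $z\in\overline{O^+(y)}$ satisfies $\overline{O^+(z)}=\overline{O^+(y)}$, and let $\Omega(X,T)$ be the non-wandering set, that is, the set of those $x\in X$ such that every neighbourhood $U$ of $x$ satisfies $T^k(U)\cap U\ne\emptyset$ for some integer $k\ge 1$. Suppose that $\overline{\mathrm M(X,T)}=\Omega(X,T)$. Then there is a set $\Psi\subset\Omega(X,T)$, dense in $\Omega(X,T)$, such that for every $x\in\Psi$ the limit $$\lim_{n\to\infty}\frac1n\log\|DT^n(x)\|$$ exists as a real number. (If $\dim X=0$ the norm is $0$, and $\log 0$ is read as $0$.) -/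

import Mathlib

open Filter Topology Bundle
open scoped Manifold ContDiff

/-- The positive semiorbit `O⁺(x) = {T^k(x) : k ≥ 0}`. -/
def posSemiorbit {X : Type*} (T : X → X) (x : X) : Set X :=
  Set.range fun k : ℕ => T^[k] x

/-- The subsystem `(K, T)` is minimal: the positive semiorbit of every point of `K` has closure
`K`. It is applied to closed invariant sets `K` only, where the closure in `K` and the closure in
`X` are the same. -/
def IsMinimalSubsystem {X : Type*} [TopologicalSpace X] (T : X → X) (K : Set X) : Prop :=
  ∀ x ∈ K, closure (posSemiorbit T x) = K

/-- The set `M(X, T)` of minimal (almost periodic) points: points `y` such that the subsystem on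
the closure of `O⁺(y)` is minimal. -/
def minimalPoints {X : Type*} [TopologicalSpace X] (T : X → X) : Set X :=
  {y | IsMinimalSubsystem T (closure (posSemiorbit T y))}

/-- A point `x` is wandering if it has a neighbourhood `U` such that `T^k(U) ∩ U = ∅` for all
`k ≥ 1`. -/
def IsWanderingPoint {X : Type*} [TopologicalSpace X] (T : X → X) (x : X) : Prop :=
  ∃ U ∈ 𝓝 x, ∀ k : ℕ, 1 ≤ k → (T^[k] '' U) ∩ U = ∅

/-- The non-wandering set `Ω(X, T)`. -/
def nonwanderingSet {X : Type*} [TopologicalSpace X] (T : X → X) : Set X :=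
  {x | ¬ IsWanderingPoint T x}

/-!
In positive dimension, write `f n x = log ‖D(T^n) x‖`. By the chain rule `f` is a subadditive cocycle
over `T`, bounded below linearly in `n` since `T` has an inverse of bounded derivative, and each
`f n` is upper semicontinuous because the metric is continuous
(`upperSemicontinuous_norm_mfderiv`).

No ergodic theorem is needed. On a compact invariant set `K`, Fekete's lemma gives the maximal
growth rate `L = lim (1/n) max_K f n = inf (1/n) max_K f n`, and some `z ∈ K` satisfies
`n * L ≤ f n z` for *all* `n ≥ 1`: if every point of `K` had a time `n ≤ N` with
`f n x < n * (L - ε)`, then cutting orbits at such times would give `max_K f M ≤ M * (L - ε) + C` for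
all `M`, against the definition of `L`; so the sets of points satisfying the inequality up to time
`N` and error `ε = 1 / (N + 1)` are nonempty, and compactness makes them meet
(`exists_forall_mul_lim_le`). By subadditivity `f n / n` then converges to `L` along the whole orbit
of `z` (`exists_forall_tendsto_div`).

If `K` is the orbit closure of a minimal point, the orbit of `z` is dense in `K`. Hence the points
with a limit are dense in the set of minimal points, so in its closure, the non-wandering set.
-/

/-! ### Maximal growth of subadditive cocycles -/

section Subadditive

variable {X : Type*} {T : X → X} {K : Set X} {f : ℕ → X → ℝ}

/-- If every point of an invariant set sees average growth less than `a` within time `N`, then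
the cocycle grows at rate at most `a` uniformly on the set. -/
lemma exists_forall_le_mul_add_of_forall_exists_le (hT : Set.MapsTo T K K)
    (hsub : ∀ m n, ∀ x ∈ K, f (m + n) x ≤ f m x + f n (T^[m] x))
    (hbdd : ∀ n, BddAbove (f n '' K)) {a : ℝ} {N : ℕ}
    (h : ∀ x ∈ K, ∃ n, 1 ≤ n ∧ n ≤ N ∧ f n x ≤ n * a) :
    ∃ C : ℝ, ∀ M, ∀ x ∈ K, f M x ≤ M * a + C := by
  choose b hb using hbdd
  have hb' : ∀ n, ∀ x ∈ K, f n x ≤ b n := fun n x hx => hb n ⟨x, hx, rfl⟩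
  refine ⟨∑ j ∈ Finset.range (N + 1), |b j - j * a|, fun M => ?_⟩
  induction M using Nat.strong_induction_on with
  | _ M ih =>
    intro x hx
    rcases le_or_gt M N with hM | hM
    · have h1 : |b M - M * a| ≤ ∑ j ∈ Finset.range (N + 1), |b j - j * a| :=
        Finset.single_le_sum (f := fun j : ℕ => |b j - j * a|) (fun _ _ => abs_nonneg _)
          (Finset.mem_range.2 (by omega))
      have h2 := le_abs_self (b M - M * a)
      linarith [hb' M x hx]
    · obtain ⟨n, hn1, hnN, hn⟩ := h x hx
      have h1 := ih (M - n) (by omega) (T^[n] x) (hT.iterate n hx)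
      have h2 := hsub n (M - n) x hx
      rw [Nat.add_sub_cancel' (by omega)] at h2
      rw [Nat.cast_sub (by omega)] at h1
      linarith

lemma subadditive_sSup_image (hne : K.Nonempty) (hT : Set.MapsTo T K K)
    (hsub : ∀ m n, ∀ x ∈ K, f (m + n) x ≤ f m x + f n (T^[m] x))
    (hbdd : ∀ n, BddAbove (f n '' K)) : Subadditive fun n => sSup (f n '' K) := by
  intro m n
  refine csSup_le (hne.image _) ?_
  rintro _ ⟨x, hx, rfl⟩
  exact (hsub m n x hx).trans (add_le_add (le_csSup (hbdd m) ⟨x, hx, rfl⟩)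
    (le_csSup (hbdd n) ⟨_, hT.iterate m hx, rfl⟩))

variable [TopologicalSpace X]

/-- An upper semicontinuous subadditive cocycle on a compact invariant set has a point along which
it grows at least at the maximal rate at all times. -/
lemma exists_forall_mul_lim_le (hK : IsCompact K) (hKc : IsClosed K) (hne : K.Nonempty)
    (hT : Set.MapsTo T K K) (husc : ∀ n, UpperSemicontinuous (f n))
    (hsub : ∀ m n, ∀ x ∈ K, f (m + n) x ≤ f m x + f n (T^[m] x))
    (hbdd : ∀ n, BddAbove (f n '' K))
    {L : ℝ} (hL : ∀ n : ℕ, n ≠ 0 → L ≤ sSup (f n '' K) / n) :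
    ∃ z ∈ K, ∀ n : ℕ, 1 ≤ n → n * L ≤ f n z := by
  let ε : ℕ → ℝ := fun N => 1 / ((N : ℝ) + 1)
  let S : ℕ → Set X := fun N =>
    K ∩ ⋂ n : ℕ, ⋂ _ : 1 ≤ n ∧ n ≤ N, f n ⁻¹' Set.Ici (n * (L - ε N))
  have hmem : ∀ N x, x ∈ S N ↔ x ∈ K ∧ ∀ n : ℕ, 1 ≤ n ∧ n ≤ N → n * (L - ε N) ≤ f n x := by
    intro N x
    simp only [S, Set.mem_inter_iff, Set.mem_iInter, Set.mem_preimage, Set.mem_Ici]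
  have hclosed : ∀ N, IsClosed (S N) := fun N =>
    hKc.inter (isClosed_iInter fun n => isClosed_iInter fun _ =>
      upperSemicontinuous_iff_isClosed_preimage.1 (husc n) _)
  have hanti : ∀ N, S (N + 1) ⊆ S N := by
    intro N x hx
    rw [hmem] at hx ⊢
    refine ⟨hx.1, fun n hn => le_trans ?_ (hx.2 n ⟨hn.1, by omega⟩)⟩
    have : ε (N + 1) ≤ ε N := by
      simp only [ε]
      push_cast
      gcongr
      linarith
    gcongr
  have hnonempty : ∀ N, (S N).Nonempty := by
    intro N
    by_contra hS
    rw [Set.not_nonempty_iff_eq_empty, Set.eq_empty_iff_forall_notMem] at hS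
    obtain ⟨C, hC⟩ := exists_forall_le_mul_add_of_forall_exists_le (a := L - ε N) (N := N)
      hT hsub hbdd (by
        intro x hx
        have := hS x
        rw [hmem] at this
        push Not at this
        obtain ⟨n, hn, h⟩ := this hx
        exact ⟨n, hn.1, hn.2, h.le⟩)
    have hε : 0 < ε N := by positivity
    obtain ⟨M, hM⟩ := exists_nat_gt (|C| / ε N)
    have hM0 : (0 : ℝ) < M := lt_of_le_of_lt (by positivity) hM
    have h1 := hL M (by rintro rfl; simp at hM0)
    rw [le_div_iff₀ hM0] at h1
    have h2 : sSup (f M '' K) ≤ M * (L - ε N) + C :=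
      csSup_le (hne.image _) (by rintro _ ⟨x, hx, rfl⟩; exact hC M x hx)
    rw [div_lt_iff₀ hε] at hM
    nlinarith [le_abs_self C]
  obtain ⟨z, hz⟩ := IsCompact.nonempty_iInter_of_sequence_nonempty_isCompact_isClosed S hanti
    hnonempty (hK.of_isClosed_subset (hclosed 0) Set.inter_subset_left) hclosed
  rw [Set.mem_iInter] at hz
  refine ⟨z, (hz 0).1, fun n hn => ?_⟩
  have hlim : Tendsto (fun N => (n : ℝ) * (L - ε N)) atTop (𝓝 (n * (L - 0))) :=
    (tendsto_const_nhds.sub tendsto_one_div_add_atTop_nhds_zero_nat).const_mul _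
  rw [sub_zero] at hlim
  refine le_of_tendsto hlim ?_
  filter_upwards [eventually_ge_atTop n] with N hN
  exact ((hmem N z).1 (hz N)).2 n ⟨hn, hN⟩

/-- An upper semicontinuous subadditive cocycle with at most linear decay on a compact invariant
set has a point such that the averages converge, to the maximal rate, along its whole orbit. -/
theorem exists_forall_tendsto_div (hK : IsCompact K) (hKc : IsClosed K) (hne : K.Nonempty)
    (hT : Set.MapsTo T K K) (husc : ∀ n, UpperSemicontinuous (f n))
    (hsub : ∀ m n, ∀ x ∈ K, f (m + n) x ≤ f m x + f n (T^[m] x))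
    {c : ℝ} (hc : ∀ n : ℕ, ∀ x ∈ K, n * c ≤ f n x) :
    ∃ z ∈ K, ∃ L : ℝ, ∀ k : ℕ, Tendsto (fun n : ℕ => f n (T^[k] z) / n) atTop (𝓝 L) := by
  have hbdd : ∀ n, BddAbove (f n '' K) := fun n =>
    (husc n).upperSemicontinuousOn K |>.bddAbove_of_isCompact hK
  have hS := subadditive_sSup_image hne hT hsub hbdd
  have hlow : BddBelow (Set.range fun n : ℕ => sSup (f n '' K) / n) := by
    refine ⟨min c 0, ?_⟩
    rintro _ ⟨n, rfl⟩
    rcases Nat.eq_zero_or_pos n with rfl | hn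
    · simp
    · refine (min_le_left _ _).trans ?_
      obtain ⟨x, hx⟩ := hne
      have hn' : (0 : ℝ) < n := by exact_mod_cast hn
      rw [le_div_iff₀ hn', mul_comm]
      exact (hc n x hx).trans (le_csSup (hbdd n) ⟨x, hx, rfl⟩)
  obtain ⟨z, hz, hzL⟩ := exists_forall_mul_lim_le hK hKc hne hT husc hsub hbdd
    (fun n hn => hS.lim_le_div hlow hn)
  refine ⟨z, hz, hS.lim, fun k => ?_⟩
  have hlim : Tendsto (fun n : ℕ => hS.lim + (k * hS.lim - f k z) / n) atTop (𝓝 hS.lim) := by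
    simpa using (tendsto_const_div_atTop_nhds_zero_nat (k * hS.lim - f k z)).const_add hS.lim
  refine tendsto_of_tendsto_of_tendsto_of_le_of_le' hlim (hS.tendsto_lim hlow) ?_ ?_
  · filter_upwards [eventually_ge_atTop 1] with n hn
    have hn' : (0 : ℝ) < n := by exact_mod_cast hn
    rw [le_div_iff₀ hn', add_mul, div_mul_cancel₀ _ hn'.ne']
    have h1 := hzL (k + n) (by omega)
    have h2 := hsub k n z hz
    push_cast at h1
    linarith
  · filter_upwards with n
    gcongr
    exact le_csSup (hbdd n) ⟨_, hT.iterate k hz, rfl⟩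

end Subadditive

/-! ### Upper semicontinuity of the norm of the derivative -/

section Bundle

variable {B : Type*} [TopologicalSpace B] {F : Type*} [NormedAddCommGroup F] [NormedSpace ℝ F]
  {V : B → Type*} [TopologicalSpace (TotalSpace F V)] [∀ x, NormedAddCommGroup (V x)]
  [∀ x, InnerProductSpace ℝ (V x)] [FiberBundle F V] [VectorBundle ℝ F V]
  [IsContinuousRiemannianBundle F V]

/-- The norm of a bundle map which is continuous in coordinates is upper semicontinuous. -/
lemma eventually_norm_lt_of_continuousAt_inCoordinates {φ : B → B} {x₀ : B}
    (hφ : ContinuousAt φ x₀) (A : ∀ x, V x →L[ℝ] V (φ x))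
    (hA : ContinuousAt (fun x =>
      ContinuousLinearMap.inCoordinates F V F V x₀ x (φ x₀) (φ x) (A x)) x₀)
    {c : ℝ} (hc : ‖A x₀‖ < c) : ∀ᶠ x in 𝓝 x₀, ‖A x‖ < c := by
  -- `G x` is the map read in coordinates, transported back to the fibers over `x₀` and `φ x₀`.
  let G : B → V x₀ →L[ℝ] V (φ x₀) := fun x =>
    ((trivializationAt F V (φ x₀)).symmL ℝ (φ x₀)) ∘L
      (ContinuousLinearMap.inCoordinates F V F V x₀ x (φ x₀) (φ x) (A x)) ∘L
      ((trivializationAt F V x₀).continuousLinearMapAt ℝ x₀)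
  have hG0 : G x₀ = A x₀ := by
    ext v
    simp only [G, ContinuousLinearMap.inCoordinates, ContinuousLinearMap.comp_apply]
    rw [Trivialization.symmL_continuousLinearMapAt _ (mem_baseSet_trivializationAt F V x₀),
      Trivialization.symmL_continuousLinearMapAt _ (mem_baseSet_trivializationAt F V (φ x₀))]
  have hG : ContinuousAt (fun x => ‖G x‖) x₀ :=
    (continuousAt_const.clm_comp (hA.clm_comp continuousAt_const)).norm
  -- The transport distorts norms by factors close to `1`.
  obtain ⟨r, hr, hrc⟩ : ∃ r : ℝ, 1 < r ∧ r * ‖A x₀‖ * r < c := by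
    have : ContinuousAt (fun r : ℝ => r * ‖A x₀‖ * r) 1 := by fun_prop
    have h := this.eventually_lt_const (by simpa using hc)
    obtain ⟨r, hr, hr1⟩ := ((h.filter_mono nhdsWithin_le_nhds).and
      (self_mem_nhdsWithin (s := Set.Ioi (1 : ℝ)))).exists
    exact ⟨r, hr1, hr⟩
  have hGr : ∀ᶠ x in 𝓝 x₀, r * ‖G x‖ * r < c :=
    ((hG.const_mul r).mul_const r).eventually_lt_const (by simpa only [hG0] using hrc)
  filter_upwards [hGr, eventually_norm_symmL_trivializationAt_self_comp_lt F V x₀ hr,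
    hφ.eventually (eventually_norm_symmL_trivializationAt_comp_self_lt F V (φ x₀) hr),
    (trivializationAt F V x₀).open_baseSet.mem_nhds (mem_baseSet_trivializationAt F V x₀),
    hφ.preimage_mem_nhds ((trivializationAt F V (φ x₀)).open_baseSet.mem_nhds
      (mem_baseSet_trivializationAt F V (φ x₀)))] with x h1 h2 h3 h4 h5
  have hfac : A x = (((trivializationAt F V (φ x₀)).symmL ℝ (φ x)) ∘L
      ((trivializationAt F V (φ x₀)).continuousLinearMapAt ℝ (φ x₀))) ∘L G x ∘L
      (((trivializationAt F V x₀).symmL ℝ x₀) ∘L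
        ((trivializationAt F V x₀).continuousLinearMapAt ℝ x)) := by
    ext v
    simp only [G, ContinuousLinearMap.inCoordinates, ContinuousLinearMap.comp_apply]
    rw [Trivialization.continuousLinearMapAt_symmL _ (mem_baseSet_trivializationAt F V x₀),
      Trivialization.continuousLinearMapAt_symmL _ (mem_baseSet_trivializationAt F V (φ x₀)),
      Trivialization.symmL_continuousLinearMapAt _ h4,
      Trivialization.symmL_continuousLinearMapAt _ h5]
  refine lt_of_le_of_lt ?_ h1
  rw [hfac]
  refine (ContinuousLinearMap.opNorm_comp_le _ _).trans ?_
  rw [mul_assoc]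
  refine mul_le_mul h3.le ?_ (norm_nonneg _) (by linarith)
  refine (ContinuousLinearMap.opNorm_comp_le _ _).trans ?_
  exact mul_le_mul_of_nonneg_left h2.le (norm_nonneg _)

end Bundle

section Manifold

variable {E : Type*} [NormedAddCommGroup E] [NormedSpace ℝ E]
  {H : Type*} [TopologicalSpace H] {I : ModelWithCorners ℝ E H}
  {X : Type*} [TopologicalSpace X] [ChartedSpace H X]

lemma upperSemicontinuous_norm_mfderiv [IsManifold I 1 X]
    [RiemannianBundle (fun x : X => TangentSpace I x)]
    [IsContinuousRiemannianBundle E (fun x : X => TangentSpace I x)]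
    {φ : X → X} (hφ : ContMDiff I I 1 φ) :
    UpperSemicontinuous fun x => ‖mfderiv I I φ x‖ := by
  intro x₀ c hc
  refine eventually_norm_lt_of_continuousAt_inCoordinates (F := E)
    (V := fun x : X => TangentSpace I x) hφ.continuous.continuousAt
    (fun x => mfderiv I I φ x) ?_ hc
  exact (hφ.contMDiffAt.mfderiv_const (m := 0) (by simp)).continuousAt

lemma norm_mfderiv_iterate_add_le [RiemannianBundle (fun x : X => TangentSpace I x)]
    {T : X → X} (hT : ContMDiff I I 1 T) (m n : ℕ) (x : X) :
    ‖mfderiv I I (T^[m + n]) x‖ ≤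
      ‖mfderiv I I (T^[n]) (T^[m] x)‖ * ‖mfderiv I I (T^[m]) x‖ := by
  rw [add_comm, Function.iterate_add, mfderiv_comp x
    ((hT.iterate n).mdifferentiable one_ne_zero _) ((hT.iterate m).mdifferentiable one_ne_zero _)]
  exact ContinuousLinearMap.opNorm_comp_le _ _

/-- Undoing the last step of `T` costs at most the norm of the derivative of the inverse. -/
lemma norm_mfderiv_iterate_le_mul [RiemannianBundle (fun x : X => TangentSpace I x)]
    (T : Diffeomorph I I X X 1) (n : ℕ) (x : X) :
    ‖mfderiv I I (T^[n]) x‖ ≤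
      ‖mfderiv I I T.symm (T^[n + 1] x)‖ * ‖mfderiv I I (T^[n + 1]) x‖ := by
  have hfun : T^[n] = T.symm ∘ T^[n + 1] := by
    funext y
    rw [Function.comp_apply, Function.iterate_succ_apply', T.symm_apply_apply]
  have h : ‖mfderiv I I (T^[n]) x‖ = ‖mfderiv I I (T.symm ∘ T^[n + 1]) x‖ :=
    congrArg (fun g : X → X => ‖mfderiv I I g x‖) hfun
  rw [h, mfderiv_comp x (T.symm.contMDiff.mdifferentiable one_ne_zero _)
    ((T.contMDiff.iterate (n + 1)).mdifferentiable one_ne_zero _)]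
  exact ContinuousLinearMap.opNorm_comp_le _ _

lemma norm_mfderiv_iterate_zero [RiemannianBundle (fun x : X => TangentSpace I x)] [Nontrivial E]
    (T : X → X) (x : X) : ‖mfderiv I I (T^[0]) x‖ = 1 := by
  have : Nontrivial (TangentSpace I x) := inferInstanceAs (Nontrivial E)
  have h : mfderiv I I (T^[0]) x = ContinuousLinearMap.id ℝ (TangentSpace I x) := mfderiv_id
  rw [h]
  exact ContinuousLinearMap.norm_id

lemma norm_mfderiv_iterate_pos [RiemannianBundle (fun x : X => TangentSpace I x)] [Nontrivial E]
    (T : Diffeomorph I I X X 1) (n : ℕ) (x : X) : 0 < ‖mfderiv I I (T^[n]) x‖ := by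
  induction n with
  | zero => rw [norm_mfderiv_iterate_zero]; exact one_pos
  | succ n ih =>
    exact pos_of_mul_pos_right (ih.trans_le (norm_mfderiv_iterate_le_mul T n x))
      (ContinuousLinearMap.opNorm_nonneg _)

/-- On a compact invariant set of a diffeomorphism, the growth rate of the derivative exists along
the whole orbit of some point. -/
theorem exists_forall_tendsto_log_norm_mfderiv_div [IsManifold I 1 X] [CompactSpace X]
    [RiemannianBundle (fun x : X => TangentSpace I x)]
    [IsContinuousRiemannianBundle E (fun x : X => TangentSpace I x)] [Nontrivial E]
    (T : Diffeomorph I I X X 1) {K : Set X} (hK : IsClosed K) (hne : K.Nonempty)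
    (hTK : Set.MapsTo T K K) :
    ∃ z ∈ K, ∃ L : ℝ, ∀ k : ℕ,
      Tendsto (fun n : ℕ => Real.log ‖mfderiv I I (T^[n]) (T^[k] z)‖ / n) atTop (𝓝 L) := by
  obtain ⟨C, hC⟩ : BddAbove ((fun x => ‖mfderiv I I T.symm x‖) '' Set.univ) :=
    ((upperSemicontinuous_norm_mfderiv T.symm.contMDiff).upperSemicontinuousOn _)
      |>.bddAbove_of_isCompact isCompact_univ
  have hC' : ∀ x, ‖mfderiv I I T.symm x‖ ≤ max C 1 := fun x =>
    (hC ⟨x, trivial, rfl⟩).trans (le_max_left _ _)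
  have hC0 : 0 < max C 1 := lt_max_of_lt_right one_pos
  refine exists_forall_tendsto_div (f := fun n x => Real.log ‖mfderiv I I (T^[n]) x‖)
    hK.isCompact hK hne hTK ?_ ?_ (c := -Real.log (max C 1)) ?_
  · intro n x c hc
    rw [Real.log_lt_iff_lt_exp (norm_mfderiv_iterate_pos T n x)] at hc
    filter_upwards [upperSemicontinuous_norm_mfderiv (T.contMDiff.iterate n) x _ hc] with y hy
    rwa [Real.log_lt_iff_lt_exp (norm_mfderiv_iterate_pos T n y)]
  · intro m n x _
    rw [← Real.log_mul (norm_mfderiv_iterate_pos T m x).ne'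
      (norm_mfderiv_iterate_pos T n _).ne', mul_comm]
    exact Real.log_le_log (norm_mfderiv_iterate_pos T _ x)
      (norm_mfderiv_iterate_add_le T.contMDiff m n x)
  · intro n x _
    induction n with
    | zero => rw [norm_mfderiv_iterate_zero]; simp
    | succ n ih =>
      have h1 : ‖mfderiv I I (T^[n]) x‖ ≤ max C 1 * ‖mfderiv I I (T^[n + 1]) x‖ :=
        (norm_mfderiv_iterate_le_mul T n x).trans
          (mul_le_mul_of_nonneg_right (hC' _) (ContinuousLinearMap.opNorm_nonneg _))
      have h2 := Real.log_le_log (norm_mfderiv_iterate_pos T n x) h1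
      rw [Real.log_mul hC0.ne' (norm_mfderiv_iterate_pos T _ x).ne'] at h2
      push_cast
      linarith

end Manifold

/-! ### Minimal points -/

section Minimal

variable {X : Type*} [TopologicalSpace X] {T : X → X}

lemma mapsTo_closure_posSemiorbit (hT : Continuous T) (x : X) :
    Set.MapsTo T (closure (posSemiorbit T x)) (closure (posSemiorbit T x)) := by
  refine Set.MapsTo.closure ?_ hT
  rintro _ ⟨k, rfl⟩
  exact ⟨k + 1, Function.iterate_succ_apply' T k x⟩

lemma mem_closure_posSemiorbit (x : X) : x ∈ closure (posSemiorbit T x) :=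
  subset_closure ⟨0, rfl⟩

lemma closure_posSemiorbit_subset_minimalPoints {y : X} (hy : y ∈ minimalPoints T) :
    closure (posSemiorbit T y) ⊆ minimalPoints T := by
  intro z hz
  have h : closure (posSemiorbit T z) = closure (posSemiorbit T y) := hy z hz
  rw [minimalPoints, Set.mem_ofPred_eq, h]
  exact hy

end Minimal

theorem corollary13p3
    {E : Type*} [NormedAddCommGroup E] [NormedSpace ℝ E] [FiniteDimensional ℝ E]
    {H : Type*} [TopologicalSpace H] (I : ModelWithCorners ℝ E H)
    {X : Type*} [TopologicalSpace X] [T2Space X] [CompactSpace X]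
    [ChartedSpace H X] [IsManifold I 1 X]
    [RiemannianBundle (fun x : X => TangentSpace I x)]
    [IsContinuousRiemannianBundle E (fun x : X => TangentSpace I x)]
    (T : Diffeomorph I I X X 1)
    (hT : closure (minimalPoints T) = nonwanderingSet T) :
    ∃ Ψ : Set X, Ψ ⊆ nonwanderingSet T ∧ nonwanderingSet T ⊆ closure Ψ ∧
      ∀ x ∈ Ψ, ∃ L : ℝ,
        Tendsto (fun n : ℕ => (1 / (n : ℝ)) * Real.log ‖mfderiv I I (T^[n]) x‖)
          atTop (𝓝 L) := by
  rcases subsingleton_or_nontrivial E with hE | hE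
  · -- In dimension zero all derivatives vanish, and `Real.log 0 = 0`.
    refine ⟨nonwanderingSet T, subset_rfl, subset_closure, fun x _ => ⟨0, ?_⟩⟩
    have h : ∀ n : ℕ, ‖mfderiv I I (T^[n]) x‖ = 0 := by
      intro n
      have : Subsingleton (TangentSpace I x) := inferInstanceAs (Subsingleton E)
      exact ContinuousLinearMap.opNorm_subsingleton _
    simp only [h, Real.log_zero, mul_zero]
    exact tendsto_const_nhds
  · refine ⟨{x | x ∈ minimalPoints T ∧ ∃ L : ℝ,
      Tendsto (fun n : ℕ => (1 / (n : ℝ)) * Real.log ‖mfderiv I I (T^[n]) x‖) atTop (𝓝 L)},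
      fun x hx => hT ▸ subset_closure hx.1, ?_, fun x hx => hx.2⟩
    rw [← hT]
    refine closure_minimal (fun y hy => ?_) isClosed_closure
    have hmaps := mapsTo_closure_posSemiorbit T.continuous y
    obtain ⟨z, hz, L, hL⟩ := exists_forall_tendsto_log_norm_mfderiv_div T isClosed_closure
      ⟨y, mem_closure_posSemiorbit y⟩ hmaps
    have hyz : y ∈ closure (posSemiorbit T z) := hy z hz ▸ mem_closure_posSemiorbit y
    refine closure_mono ?_ hyz
    rintro _ ⟨k, rfl⟩
    refine ⟨closure_posSemiorbit_subset_minimalPoints hy (hmaps.iterate k hz), L, ?_⟩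
    simpa only [one_div, inv_mul_eq_div] using hL k
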